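/- **Setting.** A rank-one transformation $T$ is an invertible measure-preserving transformation of a measure space $(X,\mu)$ given by cutting and stacking with parameters $r_n\ge 2$ and $s_{n,k}\in\mathbb Z_{\ge 0}$ ($n\ge 0$, $0\le k<r_n$). Put $h_0=1$, $h_{n+1}=\sum_{k=0}^{r_n-1}(h_n+s_{n,k})$ and $$H_n=\{0\}\cup\Big\{\sum_{k=0}^{i}(h_n+s_{n,k}) : 0\le i<r_n-1\Big\}.$$ There are measurable sets $B_n$, with $0<\mu(B_0)<\infty$, such that for each $n$ the levels $B_n,TB_n,\dots,T^{h_n-1}B_n$ are pairwise disjoint (they form the column $C_n$), $B_n=\bigcup_{e\in H_n}T^eB_{n+1}$, and for every measurable $A$ of finite measure and every $\varepsilon>0$, for all large $n$ some union $B_n'$ of levels of $C_n$ satisfies $\mu(A\triangle B'_n)<\varepsilon$. The construction is *normal* if $s_{n,r_n-1}>0$ for infinitely many $n$, and *steep* if $t'\ge 5t$ for any two successive elements $t<t'$ of $\bigcup_n H_n\setminus\{0\}$. $T$ is *rationally weakly mixing* if there is a measurable set $F$ with $0<\mu(F)<\infty$ and $\mu(X\setminus\bigcup_{i\ge0}T^iF)=0$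 such that, with $u_k(F)=\mu(F\cap T^kF)/\mu(F)^2$ and $a_n(F)=\sum_{k=0}^{n-1}u_k(F)$, for all measurable $A,B\subset F$, $$\frac1{a_n(F)}\sum_{k=0}^{n-1}\big|\mu(A\cap T^kB)-\mu(A)\mu(B)u_k(F)\big|\to 0\qquad(n\to\infty).$$ **Theorem.** 1. Let $T$ be a normal rank-one transformation such that for all $N\in\mathbb N$ and all $d_i,d_i',e_i,e_i'\in H_i$ ($0\le i<N$), the equality $\sum_{i=0}^{N-1}(d_i-d_i')=\sum_{i=0}^{N-1}(e_i-e_i')$ implies $d_i-d_i'=e_i-e_i'$ for all $0\le i\le N-1$. Then $T$ is not rationally weakly mixing. 2. If a rank-one transformation $T$ is steep, then $T$ is not rationally weakly mixing. 3. There exists a rank-one transformation, on a standard Borel space with a $\sigma$-finite measure and with $\mu(B_0)=1$, such that $r_n=n+2$, $s_{n,0}=0$ and $$H_n=\{0\}\cup\Big\{i\cdot5^{\frac{n(n+1)}2}: 1\le i\le\lceil\sqrt n\rceil\Big\}\cup\Big\{5^{\frac{n(n+1)}2+i}:\lceil\sqrt n\rceil\le i\le n\Big\}$$ for all $n\ge0$;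 and every rank-one transformation with these parameters is not rationally weakly mixing. -/

import Mathlib

open MeasureTheory Filter

universe u

/-- Parameters of a cutting and stacking construction: the column `C_n` is cut into `r n ≥ 2`
subcolumns, and `s n k` spacers are put above its `k`-th subcolumn, `0 ≤ k < r n`
(the values `s n k` with `k ≥ r n` play no role). -/
structure CutStack where
  r : ℕ → ℕ
  s : ℕ → ℕ → ℕ
  two_le_r : ∀ n, 2 ≤ r n

namespace CutStack

/-- The height `h_n` of the column `C_n`; the column `C_0` is a single level. -/
def height (P : CutStack) : ℕ → ℕ
  | 0 => 1
  | n + 1 => ∑ k ∈ Finset.range (P.r n), (height P n + P.s n k)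

/-- The height set `H_n = {0} ∪ {∑_{k ≤ i} (h_n + s_{n,k}) : 0 ≤ i < r_n - 1}`: the heights, in
`C_{n+1}`, of the bottom levels of the `r_n` copies of `C_n`. -/
def heightSet (P : CutStack) (n : ℕ) : Finset ℕ :=
  (Finset.range (P.r n)).image fun i => ∑ k ∈ Finset.range i, (P.height n + P.s n k)

/-- Infinitely often, at least one spacer is put above the rightmost subcolumn. -/
def Normal (P : CutStack) : Prop :=
  {n : ℕ | 0 < P.s n (P.r n - 1)}.Infinite

/-- Unique representation by sums of differences of elements of the height sets. -/
def UniqueDifferences (P : CutStack) : Prop :=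
  ∀ (N : ℕ) (d d' e e' : ℕ → ℕ),
    (∀ i < N, d i ∈ P.heightSet i ∧ d' i ∈ P.heightSet i ∧
      e i ∈ P.heightSet i ∧ e' i ∈ P.heightSet i) →
    ∑ i ∈ Finset.range N, ((d i : ℤ) - (d' i : ℤ)) =
      ∑ i ∈ Finset.range N, ((e i : ℤ) - (e' i : ℤ)) →
    ∀ i < N, (d i : ℤ) - (d' i : ℤ) = (e i : ℤ) - (e' i : ℤ)

/-- The set `H` of all nonzero heights. -/
def allHeights (P : CutStack) : Set ℕ :=
  {t | t ≠ 0 ∧ ∃ j, t ∈ P.heightSet j}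

/-- Steepness: `b ≥ 5 a` for any two successive elements `a < b` of `H`. -/
def Steep (P : CutStack) : Prop :=
  ∀ a ∈ P.allHeights, ∀ b ∈ P.allHeights, a < b →
    (∀ c ∈ P.allHeights, ¬ (a < c ∧ c < b)) → 5 * a ≤ b

end CutStack

/-- `T` is the rank-one transformation obtained by cutting and stacking with parameters `P`, where
the column `C_n` consists of the levels `B n, T (B n), …, T^{h_n - 1} (B n)`. -/
structure IsRankOneBy {X : Type u} [MeasurableSpace X] (μ : Measure X) (T : X ≃ᵐ X)
    (P : CutStack) (B : ℕ → Set X) : Prop where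
  measurePreserving : MeasurePreserving T μ μ
  measurableSet_base : ∀ n, MeasurableSet (B n)
  base_zero_pos : 0 < μ (B 0)
  base_zero_lt_top : μ (B 0) < ⊤
  /-- the levels of a column are pairwise disjoint -/
  levels_disjoint : ∀ n, ∀ i < P.height n, ∀ j < P.height n, i ≠ j →
    Disjoint (T^[i] '' B n) (T^[j] '' B n)
  /-- `C_{n+1}` consists of `r n` copies of `C_n`, stacked at the heights given by `H_n` -/
  base_eq : ∀ n, B n = ⋃ e ∈ P.heightSet n, T^[e] '' B (n + 1)
  /-- every set of finite measure is approximated by unions of levels of `C_n`, for all large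
  `n` -/
  approx : ∀ A : Set X, MeasurableSet A → μ A < ⊤ → ∀ ε : ENNReal, 0 < ε →
    ∃ N, ∀ n ≥ N, ∃ S ⊆ Finset.range (P.height n),
      μ (symmDiff A (⋃ i ∈ S, T^[i] '' B n)) < ε

section RationalWeakMixing

variable {X : Type u} [MeasurableSpace X]

/-- The intrinsic weight `u_k(F) = μ(F ∩ T^k F) / μ(F)²`. -/
noncomputable def intrinsicWeight (μ : Measure X) (T : X ≃ᵐ X) (F : Set X) (k : ℕ) : ℝ :=
  μ.real (F ∩ T^[k] '' F) / μ.real F ^ 2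

/-- `a_n(F) = ∑_{k < n} u_k(F)`. -/
noncomputable def weightSum (μ : Measure X) (T : X ≃ᵐ X) (F : Set X) (n : ℕ) : ℝ :=
  ∑ k ∈ Finset.range n, intrinsicWeight μ T F k

/-- Almost every point lies in `⋃_{i ≥ 0} T^i F`. -/
def SweepsOut (μ : Measure X) (T : X ≃ᵐ X) (F : Set X) : Prop :=
  μ (⋃ i : ℕ, T^[i] '' F)ᶜ = 0

/-- Rational weak mixing. -/
def RationallyWeaklyMixing (μ : Measure X) (T : X ≃ᵐ X) : Prop :=
  ∃ F : Set X, MeasurableSet F ∧ 0 < μ F ∧ μ F < ⊤ ∧ SweepsOut μ T F ∧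
    ∀ A B : Set X, MeasurableSet A → MeasurableSet B → A ⊆ F → B ⊆ F →
      Tendsto (fun n : ℕ => 1 / weightSum μ T F n * ∑ k ∈ Finset.range n,
        |μ.real (A ∩ T^[k] '' B) - μ.real A * μ.real B * intrinsicWeight μ T F k|)
        atTop (nhds 0)

end RationalWeakMixing

/-- The height sets of the zero-type, multiply recurrent example: with `q = 5^{n(n+1)/2}` and
`m = ⌈√n⌉`, the set `{0} ∪ {q, 2q, …, mq} ∪ {5^m q, 5^{m+1} q, …, 5^n q}`. -/
noncomputable def exampleHeights (n : ℕ) : Finset ℕ :=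
  {0} ∪ (Finset.Icc 1 ⌈Real.sqrt n⌉₊).image (fun i => i * 5 ^ (n * (n + 1) / 2)) ∪
    (Finset.Icc ⌈Real.sqrt n⌉₊ n).image (fun i => 5 ^ (n * (n + 1) / 2 + i))

/-- The cutting and stacking parameters of that example: `r_n = n + 2`, no spacers on the first
subcolumn, and the height sets `exampleHeights n`. -/
def IsZeroTypeExample (P : CutStack) : Prop :=
  (∀ n, P.r n = n + 2) ∧ (∀ n, P.s n 0 = 0) ∧ ∀ n, P.heightSet n = exampleHeights n

/-! One obstruction gives all the negative statements. A set `F` of positive finite measure must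
meet two different sublevels, at heights `e ≠ e'` in `H_n`, of a single level of `C_n`; call the
traces `A` and `A'`. If `μ(A ∩ T^k A) > 0`, then `k` is a sum of differences of heights whose `n`-th
term is `e - e = 0`; if `μ(A ∩ T^k A') > 0`, the `n`-th term is `e - e' ≠ 0`. When such
representations are unique, no `k` is of both kinds, so for every `k` one of the two deviations from
`u_k(F)` is total, and the two averages sum to at least `min (μ(A)²) (μ(A)μ(A')) > 0`. Steepness
yields uniqueness because the largest height with a nonzero coefficient outweighs all smaller ones.
The explicit example yields it by divisibility, looking instead at the lowest nonzero term. The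
example is realised as `x ↦ x + 1` on `ℤ_[5]`: its column heights are powers of 5, so disjointness
of levels is incongruence modulo `h_n`. The measure on `B_0` comes from Haar measure on digit
sequences; the supremum of its integer translates is invariant, and it gives `B_0` no extra mass
because translation back into `B_0` does not increase measure (`baseMeasure_translate_le`). -/

theorem ENNReal.tendsto_zero_of_two_mul_le {w : ℕ → ENNReal} (h0 : w 0 ≠ ⊤)
    (hw : ∀ n, 2 * w (n + 1) ≤ w n) : Tendsto w atTop (nhds 0) := by
  have hle : ∀ n, w n ≤ (2⁻¹ : ENNReal) ^ n * w 0 := by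
    intro n
    induction n with
    | zero => simp
    | succ n ih =>
      calc w (n + 1) = 2⁻¹ * (2 * w (n + 1)) := by
            rw [← mul_assoc, ENNReal.inv_mul_cancel (by simp) (by simp), one_mul]
        _ ≤ 2⁻¹ * ((2⁻¹ : ENNReal) ^ n * w 0) := mul_le_mul_right ((hw n).trans ih) _
        _ = _ := by rw [pow_succ' (2⁻¹ : ENNReal) n, mul_assoc]
  have h1 : Tendsto (fun n => (2⁻¹ : ENNReal) ^ n * w 0) atTop (nhds (0 * w 0)) :=
    ENNReal.Tendsto.mul_const (ENNReal.tendsto_pow_atTop_nhds_zero_of_lt_one (by simp))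
      (Or.inr h0)
  rw [zero_mul] at h1
  exact tendsto_of_tendsto_of_tendsto_of_le_of_le tendsto_const_nhds h1 (fun _ => zero_le) hle

/-! ### Elementary bounds on heights. -/

namespace CutStack

variable (P : CutStack)

theorem zero_mem_heightSet (n : ℕ) : 0 ∈ P.heightSet n :=
  Finset.mem_image.2 ⟨0, Finset.mem_range.2 (by have := P.two_le_r n; omega), by simp⟩

theorem height_pos (n : ℕ) : 0 < P.height n := by
  cases n with
  | zero => simp [height]
  | succ n =>
    have ih := height_pos n
    exact Finset.sum_pos (fun k _ => by omega) ⟨0, Finset.mem_range.2 (by have := P.two_le_r n; omega)⟩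

theorem add_height_le_of_mem_heightSet {n e : ℕ} (he : e ∈ P.heightSet n) :
    e + P.height n ≤ P.height (n + 1) := by
  obtain ⟨i, hi, rfl⟩ := Finset.mem_image.1 he
  have h : ∑ k ∈ Finset.range (i + 1), (P.height n + P.s n k) ≤ P.height (n + 1) :=
    Finset.sum_le_sum_of_subset (Finset.range_subset_range.2 (Finset.mem_range.1 hi))
  rw [Finset.sum_range_succ] at h
  omega

theorem height_le_of_mem_heightSet {n e : ℕ} (he : e ∈ P.heightSet n) (h0 : e ≠ 0) :
    P.height n ≤ e := by
  obtain ⟨i, hi, rfl⟩ := Finset.mem_image.1 he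
  cases i with
  | zero => simp at h0
  | succ i => rw [Finset.sum_range_succ']; omega

theorem exists_ne_zero_mem_heightSet (n : ℕ) : ∃ e ∈ P.heightSet n, e ≠ 0 := by
  refine ⟨_, Finset.mem_image_of_mem _ (Finset.mem_range.2 (P.two_le_r n)), ?_⟩
  have := P.height_pos n
  simp
  omega

end CutStack

namespace MeasurableEquiv

variable {X : Type u} [MeasurableSpace X] (T : X ≃ᵐ X)

theorem iterate_image_add (i j : ℕ) (S : Set X) : T^[i + j] '' S = T^[i] '' (T^[j] '' S) := by
  rw [Function.iterate_add, Set.image_comp]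

theorem measurableSet_iterate_image {S : Set X} (hS : MeasurableSet S) (i : ℕ) :
    MeasurableSet (T^[i] '' S) := by
  induction i with
  | zero => simpa using hS
  | succ i ih => rw [add_comm, iterate_image_add]; exact (T.measurableSet_image).2 ih

theorem measure_iterate_image {μ : Measure X} (hT : MeasurePreserving T μ μ) (S : Set X) (i : ℕ) :
    μ (T^[i] '' S) = μ S := by
  induction i with
  | zero => simp
  | succ i ih =>
    rw [add_comm, iterate_image_add, Function.iterate_one, T.image_eq_preimage_symm,
      (MeasurePreserving.symm T hT).measure_preimage_equiv, ih]

end MeasurableEquiv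

/-! ### Return times and the obstruction to rational weak mixing. -/

namespace IsRankOneBy

open MeasurableEquiv

variable {X : Type u} [MeasurableSpace X] {μ : Measure X} {T : X ≃ᵐ X} {P : CutStack}
  {B : ℕ → Set X}

theorem iterate_image_base_eq (h : IsRankOneBy μ T P B) (n i : ℕ) :
    T^[i] '' B n = ⋃ e ∈ P.heightSet n, T^[i + e] '' B (n + 1) := by
  conv_lhs => rw [h.base_eq n]
  simp_rw [Set.image_iUnion, iterate_image_add]

theorem two_mul_measure_base_succ_le (h : IsRankOneBy μ T P B) (n : ℕ) :
    2 * μ (B (n + 1)) ≤ μ (B n) := by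
  obtain ⟨e, he, h0⟩ := P.exists_ne_zero_mem_heightSet n
  have hlt : e < P.height (n + 1) := by
    have := P.add_height_le_of_mem_heightSet he
    have := P.height_pos n
    omega
  have hd := h.levels_disjoint (n + 1) 0 (P.height_pos _) e hlt h0.symm
  have hsub : T^[0] '' B (n + 1) ∪ T^[e] '' B (n + 1) ⊆ B n := by
    rw [h.base_eq n]
    exact Set.union_subset (Set.subset_biUnion_of_mem (u := fun e => T^[e] '' B (n + 1))
      (P.zero_mem_heightSet n)) (Set.subset_biUnion_of_mem (u := fun e => T^[e] '' B (n + 1)) he)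
  have := measure_mono (μ := μ) hsub
  rwa [measure_union hd (measurableSet_iterate_image T (h.measurableSet_base _) _),
    measure_iterate_image T h.measurePreserving, measure_iterate_image T h.measurePreserving,
    ← two_mul] at this

theorem tendsto_measure_base (h : IsRankOneBy μ T P B) :
    Tendsto (fun n => μ (B n)) atTop (nhds 0) :=
  ENNReal.tendsto_zero_of_two_mul_le h.base_zero_lt_top.ne h.two_mul_measure_base_succ_le

/-- The itinerary of a point of the level `T^(i+e) B_{n+1}` through the later columns. -/
theorem exists_digits (h : IsRankOneBy μ T P B) {n i e : ℕ} (hi : i < P.height n)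
    (he : e ∈ P.heightSet n) {x : X} (hx : x ∈ T^[i + e] '' B (n + 1)) {N : ℕ} (hN : n + 1 ≤ N) :
    ∃ d : ℕ → ℕ, (∀ j, d j ∈ P.heightSet j) ∧ d n = e ∧
      i + ∑ j ∈ Finset.range N, d j < P.height N ∧
      x ∈ T^[i + ∑ j ∈ Finset.range N, d j] '' B N := by
  induction N, hN using Nat.le_induction with
  | base =>
    -- The position inside `C_n` is already recorded by `i`, so the digits below `n` are set to 0.
    have hs : ∑ j ∈ Finset.range (n + 1), Function.update (fun _ => 0) n e j = e := by
      rw [Finset.sum_range_succ, Finset.sum_eq_zero, Function.update_self, zero_add]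
      intro j hj
      rw [Function.update_of_ne (Finset.mem_range.1 hj).ne]
    refine ⟨Function.update (fun _ => 0) n e, fun j => ?_, Function.update_self .., ?_, ?_⟩
    · rcases eq_or_ne j n with rfl | hj
      · rwa [Function.update_self]
      · rw [Function.update_of_ne hj]
        exact P.zero_mem_heightSet j
    · rw [hs]
      have := P.add_height_le_of_mem_heightSet he
      omega
    · rwa [hs]
  | succ N hN ih =>
    obtain ⟨d, hd, hdn, hlt, hxN⟩ := ih
    rw [h.iterate_image_base_eq N] at hxN
    simp only [Set.mem_iUnion] at hxN
    obtain ⟨f, hf, hxf⟩ := hxN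
    have hs : ∑ j ∈ Finset.range (N + 1), Function.update d N f j =
        ∑ j ∈ Finset.range N, d j + f := by
      rw [Finset.sum_range_succ, Function.update_self]
      congr 1
      exact Finset.sum_congr rfl fun j hj => Function.update_of_ne (Finset.mem_range.1 hj).ne _ _
    refine ⟨Function.update d N f, fun j => ?_, ?_, ?_, ?_⟩
    · rcases eq_or_ne j N with rfl | hj
      · rwa [Function.update_self]
      · rw [Function.update_of_ne hj]
        exact hd j
    · rw [Function.update_of_ne (by omega), hdn]
    · rw [hs]
      have := P.add_height_le_of_mem_heightSet hf
      omega
    · rwa [hs, ← add_assoc]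

/-- A time of return from one sublevel to another is a sum of differences of heights. -/
theorem eventually_exists_digits_sub (h : IsRankOneBy μ T P B) {n i e e' k : ℕ}
    (hi : i < P.height n) (he : e ∈ P.heightSet n) (he' : e' ∈ P.heightSet n) {A A' : Set X}
    (hA : A ⊆ T^[i + e] '' B (n + 1)) (hA' : A' ⊆ T^[i + e'] '' B (n + 1))
    (hk : μ (A ∩ T^[k] '' A') ≠ 0) :
    ∀ᶠ N in atTop, ∃ d d' : ℕ → ℕ, (∀ j, d j ∈ P.heightSet j) ∧ (∀ j, d' j ∈ P.heightSet j) ∧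
      d n = e ∧ d' n = e' ∧ ∑ j ∈ Finset.range N, ((d j : ℤ) - (d' j : ℤ)) = k := by
  have ht : Tendsto (fun N => (k : ENNReal) * μ (B N)) atTop (nhds (k * 0)) :=
    ENNReal.Tendsto.const_mul h.tendsto_measure_base (Or.inr (ENNReal.natCast_ne_top k))
  rw [mul_zero] at ht
  filter_upwards [ht.eventually_lt_const (pos_iff_ne_zero.2 hk), eventually_gt_atTop n] with N hN hnN
  -- Points that leave `C_N` through its top within `k` steps end up in these `k` sets; their total
  -- measure tends to 0, so a point of `A ∩ T^k A'` avoids them.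
  have hU : μ (⋃ m ∈ Finset.range k, T^[P.height N + m] '' B N) ≤ k * μ (B N) := by
    refine (measure_biUnion_finset_le _ _).trans ?_
    simp [measure_iterate_image T h.measurePreserving]
  obtain ⟨x, ⟨hxA, y, hyA', hyx⟩, hxU⟩ := Set.not_subset.1 fun hsub =>
    ((measure_mono hsub).trans hU).not_gt hN
  obtain ⟨d, hd, hdn, hlt, hx⟩ := h.exists_digits hi he (hA hxA) hnN
  obtain ⟨d', hd', hdn', hlt', hy⟩ := h.exists_digits hi he' (hA' hyA') hnN
  have hx' : x ∈ T^[k + (i + ∑ j ∈ Finset.range N, d' j)] '' B N := by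
    rw [iterate_image_add, ← hyx]
    exact Set.mem_image_of_mem _ hy
  have hkey : i + ∑ j ∈ Finset.range N, d j = k + (i + ∑ j ∈ Finset.range N, d' j) := by
    by_contra hne
    rcases lt_or_ge (k + (i + ∑ j ∈ Finset.range N, d' j)) (P.height N) with hl | hl
    · exact (h.levels_disjoint N _ hlt _ hl hne).le_bot ⟨hx, hx'⟩
    · refine hxU (Set.mem_biUnion (x := k + (i + ∑ j ∈ Finset.range N, d' j) - P.height N)
        (Finset.mem_coe.2 (Finset.mem_range.2 (by omega))) ?_)
      rwa [Nat.add_sub_cancel' hl]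
  refine ⟨d, d', hd, hd', hdn, hdn', ?_⟩
  rw [Finset.sum_sub_distrib, ← Nat.cast_sum, ← Nat.cast_sum]
  omega

/-- A set of positive finite measure meets two subcolumns of a level. -/
theorem exists_two_sublevels (h : IsRankOneBy μ T P B) {F : Set X} (hF : MeasurableSet F)
    (h0 : 0 < μ F) (hfin : μ F < ⊤) :
    ∃ n i, i < P.height n ∧ ∃ e ∈ P.heightSet n, ∃ e' ∈ P.heightSet n, e ≠ e' ∧
      μ (F ∩ T^[i + e] '' B (n + 1)) ≠ 0 ∧ μ (F ∩ T^[i + e'] '' B (n + 1)) ≠ 0 := by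
  by_contra! hcon
  -- With error below `μ F`, the approximating union cannot be almost disjoint from `F`.
  obtain ⟨n, hn⟩ := h.approx F hF hfin (μ F) h0
  obtain ⟨S, hS, hμ⟩ := hn n le_rfl
  have hlevel : ∃ i < P.height n, μ (F ∩ T^[i] '' B n) ≠ 0 := by
    by_contra! hz
    refine hμ.not_ge ?_
    have hz' : μ (F ∩ ⋃ i ∈ S, T^[i] '' B n) = 0 := by
      rw [Set.inter_iUnion₂]
      exact (measure_biUnion_null_iff S.countable_toSet).2
        fun i hi => hz i (Finset.mem_range.1 (hS hi))
    rw [← measure_sdiff_null' hz']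
    exact measure_mono fun x hx => Or.inl hx
  obtain ⟨i, hi, hpos⟩ := hlevel
  -- If `F` never met two sublevels of a level, its mass in one level would pass undivided to a
  -- single level of each later column, although the measure of a level tends to 0.
  have hconc : ∀ m ≥ n, ∃ j < P.height m,
      μ (F ∩ T^[i] '' B n) ≤ μ (F ∩ T^[j] '' B m) := by
    intro m hm
    induction m, hm using Nat.le_induction with
    | base => exact ⟨i, hi, le_rfl⟩
    | succ m hm ih =>
      obtain ⟨j, hj, hle⟩ := ih
      have hne : μ (F ∩ T^[j] '' B m) ≠ 0 := ((pos_iff_ne_zero.2 hpos).trans_le hle).ne'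
      rw [h.iterate_image_base_eq m j, Set.inter_iUnion₂] at hne hle
      obtain ⟨e, he, hpe⟩ : ∃ e ∈ P.heightSet m, μ (F ∩ T^[j + e] '' B (m + 1)) ≠ 0 := by
        by_contra! hz
        exact hne ((measure_biUnion_null_iff (P.heightSet m).countable_toSet).2 hz)
      refine ⟨j + e, ?_, hle.trans ((measure_biUnion_finset_le _ _).trans_eq ?_)⟩
      · have := P.add_height_le_of_mem_heightSet he
        omega
      · exact Finset.sum_eq_single e
          (fun e' he' hee => hcon m j hj e he e' he' hee.symm hpe) (fun h => absurd he h)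
  have hlt := h.tendsto_measure_base.eventually_lt_const (pos_iff_ne_zero.2 hpos)
  obtain ⟨m, hm, hmn⟩ := (hlt.and (eventually_ge_atTop n)).exists
  obtain ⟨j, -, hj⟩ := hconc m hmn
  refine (hj.trans (measure_mono Set.inter_subset_right)).not_gt ?_
  rwa [measure_iterate_image T h.measurePreserving]

theorem not_rationallyWeaklyMixing (h : IsRankOneBy μ T P B) (hP : P.UniqueDifferences) :
    ¬ RationallyWeaklyMixing μ T := by
  rintro ⟨F, hF, h0, hfin, -, hmix⟩
  obtain ⟨n, i, hi, e, he, e', he', hne, hpos, hpos'⟩ := h.exists_two_sublevels hF h0 hfin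
  have hlev : ∀ j, MeasurableSet (F ∩ T^[j] '' B (n + 1)) := fun j =>
    hF.inter (measurableSet_iterate_image T (h.measurableSet_base _) j)
  set A := F ∩ T^[i + e] '' B (n + 1) with hAdef
  set A' := F ∩ T^[i + e'] '' B (n + 1) with hAdef'
  have hdisj : ∀ k : ℕ, μ (A ∩ T^[k] '' A) = 0 ∨ μ (A ∩ T^[k] '' A') = 0 := by
    intro k
    by_contra! hcon
    -- Uniqueness compares representations of the same length `N`, and `N > n` is needed to read off
    -- the `n`-th term.
    obtain ⟨N, ⟨⟨c, c', hc, hc', hcn, hcn', hcs⟩, d, d', hd, hd', hdn, hdn', hds⟩, hN⟩ :=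
      (((h.eventually_exists_digits_sub hi he he Set.inter_subset_right Set.inter_subset_right
        hcon.1).and (h.eventually_exists_digits_sub hi he he' Set.inter_subset_right
        Set.inter_subset_right hcon.2)).and (eventually_gt_atTop n)).exists
    have := hP N c c' d d' (fun j _ => ⟨hc j, hc' j, hd j, hd' j⟩) (hcs.trans hds.symm) n hN
    omega
  have hfinA : ∀ j, μ (F ∩ T^[j] '' B (n + 1)) ≠ ⊤ := fun j =>
    ((measure_mono Set.inter_subset_left).trans_lt hfin).ne
  have hA : 0 < μ.real A := ENNReal.toReal_pos hpos (hfinA _)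
  have hA' : 0 < μ.real A' := ENNReal.toReal_pos hpos' (hfinA _)
  have hu : ∀ k, 0 ≤ intrinsicWeight μ T F k := fun k => by unfold intrinsicWeight; positivity
  have hlim := (hmix A A (hlev _) (hlev _) Set.inter_subset_left Set.inter_subset_left).add
    (hmix A A' (hlev _) (hlev _) Set.inter_subset_left Set.inter_subset_left)
  rw [add_zero] at hlim
  have hc : 0 < min (μ.real A * μ.real A) (μ.real A * μ.real A') := by positivity
  -- Termwise, the deviation whose intersection is null is a full product of measures times
  -- `u_k(F)`; summing over `k` and dividing by `a_N(F)` leaves the minimum.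
  refine (ge_of_tendsto hlim (b := min (μ.real A * μ.real A) (μ.real A * μ.real A')) ?_).not_gt hc
  filter_upwards [eventually_gt_atTop 0] with N hN
  have hw : 0 < weightSum μ T F N := by
    refine Finset.sum_pos' (fun k _ => hu k) ⟨0, Finset.mem_range.2 hN, ?_⟩
    have : 0 < μ.real F := ENNReal.toReal_pos h0.ne' hfin.ne
    simp only [intrinsicWeight, Function.iterate_zero, Set.image_id, Set.inter_self]
    positivity
  rw [← mul_add, ← Finset.sum_add_distrib, one_div, ← div_eq_inv_mul, le_div_iff₀ hw, weightSum,
    Finset.mul_sum]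
  refine Finset.sum_le_sum fun k _ => ?_
  have huk := hu k
  rcases hdisj k with hz | hz
  · have hr : μ.real (A ∩ T^[k] '' A) = 0 := by simp [Measure.real, hz]
    rw [hr, zero_sub, abs_neg, abs_of_nonneg (by positivity)]
    exact (mul_le_mul_of_nonneg_right (min_le_left _ _) huk).trans
      (le_add_of_nonneg_right (abs_nonneg _))
  · have hr : μ.real (A ∩ T^[k] '' A') = 0 := by simp [Measure.real, hz]
    rw [hr, zero_sub, abs_neg, abs_of_nonneg (by positivity : 0 ≤ μ.real A * μ.real A' * _)]
    exact (mul_le_mul_of_nonneg_right (min_le_right _ _) huk).trans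
      (le_add_of_nonneg_left (abs_nonneg _))

end IsRankOneBy

/-! ### Steepness implies unique differences. -/

/-- Geometric series: 1/5 + 1/25 + … = 1/4. Inductively, the elements below the maximum `a` sum to
at most `a/4`, and `5a/4 ≤ m/4`. -/
theorem Finset.four_mul_sum_le_of_growth (S : Finset ℕ)
    (hS : ∀ a ∈ S, ∀ b ∈ S, a < b → 5 * a ≤ b) (m : ℕ) (hm : ∀ a ∈ S, 5 * a ≤ m) :
    4 * ∑ a ∈ S, a ≤ m := by
  induction S using Finset.induction_on_max generalizing m with
  | empty => simp
  | insert a S hlt ih =>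
    rw [Finset.sum_insert fun h => (hlt a h).ne rfl]
    have h1 := ih (fun x hx y hy => hS x (Finset.mem_insert_of_mem hx) y (Finset.mem_insert_of_mem hy))
      a (fun x hx => hS x (Finset.mem_insert_of_mem hx) a (Finset.mem_insert_self _ _) (hlt x hx))
    have h2 := hm a (Finset.mem_insert_self _ _)
    omega

/-- A nonzero coefficient at the maximum `m` contributes at least `m` in absolute value, while the
rest contributes at most `2 · m/4`. So the top coefficient vanishes, and one descends. -/
theorem Finset.eq_zero_of_sum_mul_eq_zero_of_growth (S : Finset ℕ) (h0 : ∀ a ∈ S, a ≠ 0)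
    (hS : ∀ a ∈ S, ∀ b ∈ S, a < b → 5 * a ≤ b) (c : ℕ → ℤ) (hc : ∀ a ∈ S, |c a| ≤ 2)
    (hsum : ∑ a ∈ S, c a * a = 0) : ∀ a ∈ S, c a = 0 := by
  induction S using Finset.induction_on_max with
  | empty => simp
  | insert m S hlt ih =>
    have hS' := fun x hx y hy =>
      hS x (Finset.mem_insert_of_mem hx) y (Finset.mem_insert_of_mem hy)
    rw [Finset.sum_insert fun h => (hlt m h).ne rfl] at hsum
    have h4 := Finset.four_mul_sum_le_of_growth S hS' m fun x hx =>
      hS x (Finset.mem_insert_of_mem hx) m (Finset.mem_insert_self _ _) (hlt x hx)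
    have hb : |∑ a ∈ S, c a * (a : ℤ)| ≤ 2 * ∑ a ∈ S, (a : ℤ) := by
      rw [Finset.mul_sum]
      refine (Finset.abs_sum_le_sum_abs _ _).trans (Finset.sum_le_sum fun a ha => ?_)
      rw [abs_mul, abs_of_nonneg (Int.natCast_nonneg a)]
      exact mul_le_mul_of_nonneg_right (hc a (Finset.mem_insert_of_mem ha)) (by positivity)
    have hm0 := h0 m (Finset.mem_insert_self _ _)
    have hcm : c m = 0 := by
      by_contra hne
      have h1 : (m : ℤ) ≤ |c m * m| := by
        rw [abs_mul, abs_of_nonneg (Int.natCast_nonneg m)]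
        exact le_mul_of_one_le_left (by positivity) (Int.one_le_abs hne)
      rw [eq_neg_of_add_eq_zero_left hsum, abs_neg] at h1
      have h5 : (4 : ℤ) * ∑ a ∈ S, (a : ℤ) ≤ m := by rw [← Nat.cast_sum]; omega
      omega
    rw [hcm, zero_mul, zero_add] at hsum
    intro a ha
    rcases Finset.mem_insert.1 ha with rfl | ha
    · exact hcm
    · exact ih (fun x hx => h0 x (Finset.mem_insert_of_mem hx)) hS'
        (fun x hx => hc x (Finset.mem_insert_of_mem hx)) hsum a ha

namespace CutStack

variable {P : CutStack}

theorem height_mono (P : CutStack) : Monotone P.height :=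
  monotone_nat_of_le_succ fun n => by
    simpa using P.add_height_le_of_mem_heightSet (P.zero_mem_heightSet n)

/-- Elements of `H_i` lie below `h_{i+1} ≤ h_j`, and nonzero elements of `H_j` are at least `h_j`.
Hence a nonzero height determines its stage. -/
theorem lt_of_mem_heightSet_of_lt {i j a b : ℕ} (hij : i < j) (ha : a ∈ P.heightSet i)
    (hb : b ∈ P.heightSet j) (hb0 : b ≠ 0) : a < b := by
  have h1 := P.add_height_le_of_mem_heightSet ha
  have h2 := P.height_pos i
  have h3 := P.height_le_of_mem_heightSet hb hb0
  have h4 := P.height_mono (Nat.succ_le_of_lt hij)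
  simp only [Nat.succ_eq_add_one] at h4
  omega

theorem Steep.five_mul_le (hP : P.Steep) {a b : ℕ} (ha : a ∈ P.allHeights)
    (hb : b ∈ P.allHeights) (hab : a < b) : 5 * a ≤ b := by
  classical
  have hex : ∃ c, c ∈ P.allHeights ∧ a < c := ⟨b, hb, hab⟩
  obtain ⟨h1, h2⟩ := Nat.find_spec hex
  exact (hP a ha _ h1 h2 fun c hc hlt => Nat.find_min hex hlt.2 ⟨hc, hlt.1⟩).trans
    (Nat.find_min' hex ⟨hb, hab⟩)

theorem Steep.uniqueDifferences (hP : P.Steep) : P.UniqueDifferences := by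
  intro N d d' e e' hmem hsum
  let K : ℕ → Finset ℕ := fun i => (P.heightSet i).erase 0
  have hK : ∀ i, ∀ a ∈ K i, a ≠ 0 ∧ a ∈ P.heightSet i := fun i a ha => Finset.mem_erase.1 ha
  have hdisj : ∀ i j a, a ∈ K i → a ∈ K j → i = j := by
    intro i j a hi hj
    rcases lt_trichotomy i j with h | h | h
    · exact absurd (lt_of_mem_heightSet_of_lt h (hK i a hi).2 (hK j a hj).2 (hK j a hj).1)
        (lt_irrefl a)
    · exact h
    · exact absurd (lt_of_mem_heightSet_of_lt h (hK j a hj).2 (hK i a hi).2 (hK i a hi).1)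
        (lt_irrefl a)
  -- The difference of the two representations is rewritten as one combination `∑ c a * a` over
  -- nonzero heights. Two indicators enter with each sign, hence `|c a| ≤ 2`.
  let δ : ℕ → ℕ → ℤ := fun x a => if x = a then 1 else 0
  let γ : ℕ → ℕ → ℤ := fun i a => δ (d i) a - δ (d' i) a - (δ (e i) a - δ (e' i) a)
  let c : ℕ → ℤ := fun a => ∑ i ∈ Finset.range N, if a ∈ K i then γ i a else 0
  have hcγ : ∀ i < N, ∀ a ∈ K i, c a = γ i a := by
    intro i hi a ha
    refine (Finset.sum_eq_single_of_mem i (Finset.mem_range.2 hi) fun j _ hj => ?_).trans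
      (if_pos ha)
    exact if_neg fun haj => hj (hdisj j i a haj ha)
  have hδ : ∀ i, ∀ x ∈ P.heightSet i, ∑ a ∈ K i, δ x a * (a : ℤ) = x := by
    intro i x hx
    rcases eq_or_ne x 0 with rfl | h0
    · refine Finset.sum_eq_zero fun a ha => ?_
      simp [δ, (hK i a ha).1.symm]
    · rw [Finset.sum_eq_single_of_mem x (Finset.mem_erase.2 ⟨h0, hx⟩)]
      · simp [δ]
      · intro b _ hb
        simp [δ, hb.symm]
  have hγ : ∀ i < N, ∑ a ∈ K i, c a * (a : ℤ) = ((d i : ℤ) - d' i) - ((e i : ℤ) - e' i) := by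
    intro i hi
    obtain ⟨h1, h2, h3, h4⟩ := hmem i hi
    rw [Finset.sum_congr rfl fun a ha => by rw [hcγ i hi a ha], ← hδ i _ h1, ← hδ i _ h2,
      ← hδ i _ h3, ← hδ i _ h4]
    simp only [γ, sub_mul, Finset.sum_sub_distrib]
  let S := (Finset.range N).biUnion K
  have hSH : ∀ a ∈ S, a ∈ P.allHeights := by
    intro a ha
    obtain ⟨i, -, hi⟩ := Finset.mem_biUnion.1 ha
    exact ⟨(hK i a hi).1, i, (hK i a hi).2⟩
  have hzero : ∀ a ∈ S, c a = 0 := by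
    refine Finset.eq_zero_of_sum_mul_eq_zero_of_growth S (fun a ha => (hSH a ha).1)
      (fun a ha b hb => hP.five_mul_le (hSH a ha) (hSH b hb)) c ?_ ?_
    · intro a ha
      obtain ⟨i, hi, hai⟩ := Finset.mem_biUnion.1 ha
      rw [hcγ i (Finset.mem_range.1 hi) a hai, abs_le]
      simp only [γ, δ]
      constructor <;> split_ifs <;> norm_num
    · rw [Finset.sum_biUnion, Finset.sum_congr rfl fun i hi => hγ i (Finset.mem_range.1 hi),
        Finset.sum_sub_distrib, hsum, sub_self]
      exact fun i _ j _ hij => Finset.disjoint_left.2 fun a hi hj => hij (hdisj i j a hi hj)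
  intro i hi
  refine sub_eq_zero.1 ((hγ i hi).symm.trans (Finset.sum_eq_zero fun a ha => ?_))
  rw [hzero a (Finset.mem_biUnion.2 ⟨i, Finset.mem_range.2 hi, ha⟩), zero_mul]

end CutStack

/-! ### Unique differences in the example. -/

/-- `5^{n(n+1)/2}`, the height of the column `C_n` of the example. -/
def exampleScale (n : ℕ) : ℕ := 5 ^ (n * (n + 1) / 2)

theorem exampleScale_succ (n : ℕ) : exampleScale (n + 1) = 5 ^ (n + 1) * exampleScale n := by
  have h : (n + 1) * (n + 1 + 1) / 2 = (n + 1) + n * (n + 1) / 2 := by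
    rw [show (n + 1) * (n + 1 + 1) = n * (n + 1) + (n + 1) * 2 by ring,
      Nat.add_mul_div_right _ _ two_pos, add_comm]
  rw [exampleScale, exampleScale, h, pow_add]

theorem exampleScale_pos (n : ℕ) : 0 < exampleScale n := by unfold exampleScale; positivity

theorem exampleScale_dvd {m n : ℕ} (h : m ≤ n) : exampleScale m ∣ exampleScale n := by
  induction n, h using Nat.le_induction with
  | base => exact dvd_rfl
  | succ n _ ih => rw [exampleScale_succ]; exact ih.mul_left _

theorem ceil_sqrt_le (n : ℕ) : ⌈Real.sqrt n⌉₊ ≤ n := by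
  refine Nat.ceil_le.2 (Real.sqrt_le_iff.2 ⟨by positivity, ?_⟩)
  exact_mod_cast Nat.le_self_pow two_ne_zero n

theorem exists_of_mem_exampleHeights {n e : ℕ} (he : e ∈ exampleHeights n) :
    ∃ c ≤ 5 ^ n, e = c * exampleScale n := by
  simp only [exampleHeights, Finset.mem_union, Finset.mem_singleton, Finset.mem_image,
    Finset.mem_Icc] at he
  rcases he with (rfl | ⟨i, ⟨-, hi⟩, rfl⟩) | ⟨i, ⟨-, hi⟩, rfl⟩
  · exact ⟨0, by positivity, by simp⟩
  · exact ⟨i, (hi.trans (ceil_sqrt_le n)).trans (Nat.lt_pow_self (by norm_num)).le, rfl⟩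
  · exact ⟨5 ^ i, Nat.pow_le_pow_right (by norm_num) hi, by rw [exampleScale, pow_add, mul_comm]⟩

/-- Once all earlier terms vanish, the later ones are divisible by `h_{i+1} = 5^(i+1) h_i`. So
`5^(i+1)` divides `c`, whereas `|c| ≤ 2 * 5^i < 5^(i+1)`. -/
theorem Int.eq_zero_of_sum_exampleScale (N : ℕ) (D : ℕ → ℤ)
    (hD : ∀ i < N, ∃ c : ℤ, |c| ≤ 2 * 5 ^ i ∧ D i = c * exampleScale i)
    (hsum : ∑ i ∈ Finset.range N, D i = 0) : ∀ i < N, D i = 0 := by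
  intro i
  induction i using Nat.strong_induction_on with
  | _ i ih =>
    intro hi
    obtain ⟨c, hc, hDc⟩ := hD i hi
    have hsplit : D i + ∑ j ∈ (Finset.range N).erase i, D j = 0 := by
      rw [Finset.add_sum_erase _ _ (Finset.mem_range.2 hi), hsum]
    have hdvd : (exampleScale (i + 1) : ℤ) ∣ ∑ j ∈ (Finset.range N).erase i, D j := by
      refine Finset.dvd_sum fun j hj => ?_
      obtain ⟨hji, hjN⟩ := Finset.mem_erase.1 hj
      rcases lt_or_gt_of_ne hji with h | h
      · rw [ih j h (Finset.mem_range.1 hjN)]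
        exact dvd_zero _
      · obtain ⟨c', -, hc'⟩ := hD j (Finset.mem_range.1 hjN)
        rw [hc']
        exact (Int.natCast_dvd_natCast.2 (exampleScale_dvd (Nat.succ_le_of_lt h))).mul_left _
    have h1 : (exampleScale (i + 1) : ℤ) ∣ c * exampleScale i := by
      rw [← hDc, eq_neg_of_add_eq_zero_left hsplit]
      exact hdvd.neg_right
    have hpos : (exampleScale i : ℤ) ≠ 0 := by exact_mod_cast (exampleScale_pos i).ne'
    rw [exampleScale_succ, Nat.cast_mul] at h1
    have h2 := Int.dvd_of_mul_dvd_mul_right hpos h1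
    have h3 : c = 0 := by
      refine Int.eq_zero_of_abs_lt_dvd h2 (hc.trans_lt ?_)
      push_cast
      rw [pow_succ]
      have : (0 : ℤ) < 5 ^ i := by positivity
      omega
    rw [hDc, h3, zero_mul]

theorem CutStack.uniqueDifferences_of_heightSet_eq {P : CutStack}
    (hP : ∀ n, P.heightSet n = exampleHeights n) : P.UniqueDifferences := by
  intro N d d' e e' hmem hsum i hi
  refine sub_eq_zero.1 (Int.eq_zero_of_sum_exampleScale N
    (fun j => ((d j : ℤ) - d' j) - ((e j : ℤ) - e' j)) (fun j hj => ?_) ?_ i hi)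
  · obtain ⟨h1, h2, h3, h4⟩ := hmem j hj
    rw [hP] at h1 h2 h3 h4
    obtain ⟨a, ha, h1⟩ := exists_of_mem_exampleHeights h1
    obtain ⟨b, hb, h2⟩ := exists_of_mem_exampleHeights h2
    obtain ⟨a', ha', h3⟩ := exists_of_mem_exampleHeights h3
    obtain ⟨b', hb', h4⟩ := exists_of_mem_exampleHeights h4
    -- Each inner difference is at most `5^j` in absolute value, whence the factor 2.
    refine ⟨((a : ℤ) - b) - ((a' : ℤ) - b'), ?_, by rw [h1, h2, h3, h4]; push_cast; ring⟩
    zify at ha hb ha' hb'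
    rw [abs_le]
    omega
  · rw [Finset.sum_sub_distrib, hsum, sub_self]

/-! ### Parameters of the example. -/

/-- The `k`-th element of the `n`-th height set of the example; the value at `k = n + 2` is the
height of the next column. -/
noncomputable def exampleHeight (n k : ℕ) : ℕ :=
  if k ≤ ⌈Real.sqrt n⌉₊ then k * exampleScale n else 5 ^ (k - 1) * exampleScale n

theorem exampleHeight_zero (n : ℕ) : exampleHeight n 0 = 0 := by simp [exampleHeight]

theorem exampleHeight_one (n : ℕ) : exampleHeight n 1 = exampleScale n := by
  unfold exampleHeight; split_ifs <;> simp

/-- Consecutive heights leave room for a copy of `C_n`, so the truncated subtraction defining the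
spacer numbers is exact. -/
theorem exampleHeight_add_le (n k : ℕ) :
    exampleHeight n k + exampleScale n ≤ exampleHeight n (k + 1) := by
  have h5 : k + 1 ≤ 5 ^ k := Nat.lt_pow_self (by norm_num)
  unfold exampleHeight
  split_ifs with h1 h2
  · exact (Nat.succ_mul _ _).ge
  · rw [← Nat.succ_mul]
    exact Nat.mul_le_mul_right _ h5
  · omega
  · rw [← Nat.succ_mul]
    refine Nat.mul_le_mul_right _ ?_
    obtain ⟨k, rfl⟩ := Nat.exists_eq_succ_of_ne_zero (show k ≠ 0 by omega)
    have : 0 < 5 ^ k := by positivity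
    simp only [Nat.succ_eq_add_one, Nat.add_sub_cancel, pow_succ]
    omega

theorem exampleHeight_strictMono (n : ℕ) : StrictMono (exampleHeight n) :=
  strictMono_nat_of_lt_succ fun k => by
    have := exampleHeight_add_le n k
    have := exampleScale_pos n
    omega

theorem exampleHeight_last (n : ℕ) : exampleHeight n (n + 2) = exampleScale (n + 1) := by
  have := ceil_sqrt_le n
  rw [exampleHeight, if_neg (by omega), exampleScale_succ]
  rfl

theorem exampleScale_dvd_exampleHeight (n k : ℕ) : exampleScale n ∣ exampleHeight n k := by
  unfold exampleHeight; split_ifs <;> exact dvd_mul_left _ _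

theorem image_exampleHeight (n : ℕ) :
    (Finset.range (n + 2)).image (exampleHeight n) = exampleHeights n := by
  have hm := ceil_sqrt_le n
  ext a
  simp only [exampleHeights, Finset.mem_union, Finset.mem_singleton, Finset.mem_image,
    Finset.mem_Icc, Finset.mem_range]
  constructor
  · rintro ⟨k, hk, rfl⟩
    rcases Nat.eq_zero_or_pos k with rfl | hk0
    · exact Or.inl (Or.inl (exampleHeight_zero n))
    · by_cases h : k ≤ ⌈Real.sqrt n⌉₊
      · exact Or.inl (Or.inr ⟨k, ⟨hk0, h⟩, by rw [exampleHeight, if_pos h]; rfl⟩)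
      · exact Or.inr ⟨k - 1, by omega, by
          rw [exampleHeight, if_neg h, exampleScale, pow_add, mul_comm]⟩
  · rintro ((rfl | ⟨k, ⟨_, hk⟩, rfl⟩) | ⟨k, ⟨hk, hkn⟩, rfl⟩)
    · exact ⟨0, by omega, exampleHeight_zero n⟩
    · exact ⟨k, by omega, by rw [exampleHeight, if_pos hk]; rfl⟩
    · exact ⟨k + 1, by omega, by
        rw [exampleHeight, if_neg (by omega), exampleScale, pow_add, mul_comm]; rfl⟩

/-- The cutting and stacking parameters of the example. -/
noncomputable def exampleCutStack : CutStack where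
  r n := n + 2
  s n k := exampleHeight n (k + 1) - exampleHeight n k - exampleScale n
  two_le_r n := by omega

theorem sum_exampleHeight_sub (n i : ℕ) :
    ∑ k ∈ Finset.range i, (exampleScale n + exampleCutStack.s n k) = exampleHeight n i := by
  induction i with
  | zero => simp [exampleHeight_zero]
  | succ i ih =>
    have := exampleHeight_add_le n i
    rw [Finset.sum_range_succ, ih, exampleCutStack]
    dsimp only
    omega

theorem height_exampleCutStack (n : ℕ) : exampleCutStack.height n = exampleScale n := by
  induction n with
  | zero => rfl
  | succ n ih =>
    rw [CutStack.height, ih]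
    exact (sum_exampleHeight_sub n (n + 2)).trans (exampleHeight_last n)

theorem heightSet_exampleCutStack (n : ℕ) :
    exampleCutStack.heightSet n = exampleHeights n := by
  rw [CutStack.heightSet, height_exampleCutStack, ← image_exampleHeight]
  simp_rw [sum_exampleHeight_sub]
  rfl

theorem isZeroTypeExample_exampleCutStack : IsZeroTypeExample exampleCutStack := by
  refine ⟨fun n => rfl, fun n => ?_, heightSet_exampleCutStack⟩
  simp [exampleCutStack, exampleHeight_zero, exampleHeight_one]

/-! ### Realisation of the levels in the 5-adic integers. -/

instance : Fact (Nat.Prime 5) := ⟨by norm_num⟩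

noncomputable instance : MeasurableSpace ℤ_[5] := borel _

instance : BorelSpace ℤ_[5] := ⟨rfl⟩

namespace ZeroTypeExample

/-- Sequences of indices of subcolumns, one for every stage of the construction. -/
abbrev Digits : Type := ∀ n : ℕ, Fin (n + 2)

/-- The height of the level of `C_n` with given indices of subcolumns. -/
noncomputable def partialHeight (n : ℕ) (g : Digits) : ℕ :=
  ∑ j ∈ Finset.range n, exampleHeight j (g j)

/-- The point of `ℤ_[5]` with given indices of subcolumns. -/
noncomputable def point (g : Digits) : ℤ_[5] := ∑' j, (exampleHeight j (g j) : ℤ_[5])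

/-- The `5`-adic norm of the height of `C_n`. -/
noncomputable def radius (n : ℕ) : ℝ := (5 : ℝ) ^ (-((n * (n + 1) / 2 : ℕ) : ℤ))

theorem partialHeight_lt (n : ℕ) (g : Digits) : partialHeight n g < exampleScale n := by
  induction n with
  | zero => simp [partialHeight, exampleScale]
  | succ n ih =>
    have h1 := exampleHeight_add_le n (g n)
    have h2 := (exampleHeight_strictMono n).monotone (show (g n : ℕ) + 1 ≤ n + 2 from (g n).2)
    rw [exampleHeight_last] at h2
    rw [partialHeight, Finset.sum_range_succ]
    rw [partialHeight] at ih
    omega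

theorem norm_intCast_le_radius_iff (n : ℕ) (a : ℤ) :
    ‖(a : ℤ_[5])‖ ≤ radius n ↔ (exampleScale n : ℤ) ∣ a := by
  have := PadicInt.norm_int_le_pow_iff_dvd (p := 5) (k := a) (n := n * (n + 1) / 2)
  rw [radius, exampleScale]
  push_cast at this ⊢
  exact this

theorem norm_exampleHeight_le {n j : ℕ} (h : n ≤ j) (k : ℕ) :
    ‖(exampleHeight j k : ℤ_[5])‖ ≤ radius n := by
  have := (norm_intCast_le_radius_iff n (exampleHeight j k)).2
    (Int.natCast_dvd_natCast.2 ((exampleScale_dvd h).trans (exampleScale_dvd_exampleHeight j k)))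
  simpa using this

theorem radius_le (n : ℕ) : radius n ≤ (5⁻¹ : ℝ) ^ n := by
  have h : n ≤ n * (n + 1) / 2 := by
    rw [Nat.le_div_iff_mul_le two_pos]
    cases n with
    | zero => simp
    | succ n => exact Nat.mul_le_mul_left _ (by omega)
  rw [radius, zpow_neg, zpow_natCast, inv_pow]
  gcongr
  norm_num

theorem norm_digit_le (j k : ℕ) : ‖(exampleHeight j k : ℤ_[5])‖ ≤ (5⁻¹ : ℝ) ^ j :=
  (norm_exampleHeight_le le_rfl k).trans (radius_le j)

theorem summable_geometric : Summable fun j : ℕ => (5⁻¹ : ℝ) ^ j :=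
  summable_geometric_of_lt_one (by norm_num) (by norm_num)

theorem summable_digits (g : Digits) : Summable fun j => (exampleHeight j (g j) : ℤ_[5]) :=
  Summable.of_norm_bounded summable_geometric fun j => norm_digit_le j _

theorem continuous_point : Continuous point := by
  refine continuous_tsum (fun j => ?_) summable_geometric fun j g => norm_digit_le j _
  exact (continuous_of_discreteTopology (f := fun k : Fin (j + 2) =>
    (exampleHeight j k : ℤ_[5]))).comp (continuous_apply j)

/-- All terms from stage `n` on are divisible by `h_n`, and the norm is ultrametric: the partial
height is the residue of the point modulo `h_n`. -/
theorem norm_point_sub_le (n : ℕ) (g : Digits) :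
    ‖point g - (partialHeight n g : ℤ_[5])‖ ≤ radius n := by
  have h := (summable_digits g).sum_add_tsum_nat_add n
  rw [point, ← h, partialHeight, Nat.cast_sum, add_sub_cancel_left]
  exact IsUltrametricDist.norm_tsum_le_of_forall_le fun j => norm_exampleHeight_le (by omega) _

/-- Integers in `[0, h_n)` that are congruent modulo `h_n` are equal. -/
theorem eq_of_norm_sub_le {n : ℕ} {a b : ℤ} (ha0 : 0 ≤ a) (ha : a < exampleScale n) (hb0 : 0 ≤ b)
    (hb : b < exampleScale n) {x : ℤ_[5]} (hxa : ‖x - a‖ ≤ radius n)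
    (hxb : ‖x - b‖ ≤ radius n) : a = b := by
  have h : ‖((a - b : ℤ) : ℤ_[5])‖ ≤ radius n := by
    have := IsUltrametricDist.norm_add_le_max (x - b) (a - x)
    rw [sub_add_sub_comm, add_comm x, add_sub_add_right_eq_sub, norm_sub_rev (a : ℤ_[5]) x] at this
    push_cast
    exact this.trans (max_le hxb hxa)
  rw [norm_intCast_le_radius_iff] at h
  refine sub_eq_zero.1 (Int.eq_zero_of_abs_lt_dvd h ?_)
  rw [abs_lt]
  omega

/-- Residues modulo every `h_n` recover the partial heights, and their successive differences
recover the digits. -/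
theorem point_injective : Function.Injective point := by
  intro g g' h
  have hn : ∀ n, partialHeight n g = partialHeight n g' := fun n => by
    have h1 := norm_point_sub_le n g
    have h2 := norm_point_sub_le n g'
    rw [← h] at h2
    exact_mod_cast eq_of_norm_sub_le (n := n) (a := partialHeight n g) (b := partialHeight n g')
      (by positivity) (by exact_mod_cast partialHeight_lt n g) (by positivity)
      (by exact_mod_cast partialHeight_lt n g') (x := point g)
      (by exact_mod_cast h1) (by exact_mod_cast h2)
  funext n
  have h1 := hn (n + 1)
  rw [partialHeight, partialHeight, Finset.sum_range_succ, Finset.sum_range_succ] at h1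
  have h2 := hn n
  rw [partialHeight, partialHeight] at h2
  exact Fin.ext ((exampleHeight_strictMono n).injective (by omega))

/-- Digits add cyclically in `Fin (j + 2)`, so additivity holds only under a condition such as
disjoint supports. -/
theorem point_add {g g' : Digits} (h : ∀ j, g j = 0 ∨ g' j = 0) :
    point (g + g') = point g + point g' := by
  rw [point, point, point, ← (summable_digits g).tsum_add (summable_digits g')]
  refine tsum_congr fun j => ?_
  rcases h j with h | h <;> simp [h, exampleHeight_zero]

theorem point_of_support {n : ℕ} {g : Digits} (h : ∀ j ≥ n, g j = 0) :
    point g = (partialHeight n g : ℤ_[5]) := by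
  rw [point, partialHeight, Nat.cast_sum]
  refine tsum_eq_sum fun j hj => ?_
  rw [h j (by simpa using hj)]
  simp [exampleHeight_zero]

/-- The digits below `n`. -/
def head (n : ℕ) (g : Digits) : Digits := fun j => if j < n then g j else 0

/-- The digits from `n` on. -/
def tail (n : ℕ) (g : Digits) : Digits := fun j => if j < n then 0 else g j

theorem point_head (n : ℕ) (g : Digits) : point (head n g) = (partialHeight n g : ℤ_[5]) := by
  rw [point_of_support (n := n) (g := head n g) fun j hj => if_neg (by omega), partialHeight,
    partialHeight]
  congr 1
  refine Finset.sum_congr rfl fun j hj => ?_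
  rw [head, if_pos (Finset.mem_range.1 hj)]

theorem point_eq_add_point_tail (n : ℕ) (g : Digits) :
    point g = partialHeight n g + point (tail n g) := by
  rw [← point_head, ← point_add fun j => ?_]
  · congr 1
    funext j
    by_cases h : j < n <;> simp [head, tail, h]
  · by_cases h : j < n <;> simp [head, tail, h]

/-- The sequences whose digits below `n` vanish. -/
def tailSet (n : ℕ) : Set Digits := {g | ∀ j < n, g j = 0}

theorem tail_mem_tailSet (n : ℕ) (g : Digits) : tail n g ∈ tailSet n := fun _ hj => if_pos hj

/-- The bottom level of `C_n`. -/
noncomputable def base (n : ℕ) : Set ℤ_[5] := point '' tailSet n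

theorem measurableSet_base (n : ℕ) : MeasurableSet (base n) := by
  have hc : IsClosed (tailSet n) := by
    simp only [tailSet, Set.ofPred_forall]
    exact isClosed_iInter fun j => isClosed_iInter fun _ =>
      isClosed_eq (continuous_apply j) continuous_const
  exact (hc.isCompact.image continuous_point).measurableSet

/-- The set `T^a B_n`. -/
noncomputable def level (n : ℕ) (a : ℤ) : Set ℤ_[5] := {x | x - a ∈ base n}

theorem measurableSet_level (n : ℕ) (a : ℤ) : MeasurableSet (level n a) :=
  (measurable_sub_const (a : ℤ_[5])) (measurableSet_base n)

theorem level_zero (n : ℕ) : level n 0 = base n := by simp [level]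

theorem norm_le_of_mem_base {n : ℕ} {x : ℤ_[5]} (hx : x ∈ base n) : ‖x‖ ≤ radius n := by
  obtain ⟨g, hg, rfl⟩ := hx
  have h : partialHeight n g = 0 := Finset.sum_eq_zero fun j hj => by
    rw [hg j (Finset.mem_range.1 hj)]
    exact exampleHeight_zero j
  simpa [h] using norm_point_sub_le n g

theorem disjoint_level {n : ℕ} {a b : ℤ} (ha0 : 0 ≤ a) (ha : a < exampleScale n) (hb0 : 0 ≤ b)
    (hb : b < exampleScale n) (hab : a ≠ b) : Disjoint (level n a) (level n b) :=
  Set.disjoint_left.2 fun _ hxa hxb => hab (eq_of_norm_sub_le ha0 ha hb0 hb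
    (norm_le_of_mem_base hxa) (norm_le_of_mem_base hxb))

theorem base_eq_iUnion (n : ℕ) : base n = ⋃ e ∈ exampleCutStack.heightSet n, level (n + 1) e := by
  ext x
  simp only [heightSet_exampleCutStack, ← image_exampleHeight, Set.mem_iUnion, Finset.mem_image,
    Finset.mem_range]
  constructor
  · rintro ⟨g, hg, rfl⟩
    refine ⟨_, ⟨g n, (g n).2, rfl⟩, tail (n + 1) g, tail_mem_tailSet _ g, ?_⟩
    have : partialHeight (n + 1) g = exampleHeight n (g n) := by
      rw [partialHeight, Finset.sum_range_succ, Finset.sum_eq_zero, zero_add]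
      intro j hj
      rw [hg j (Finset.mem_range.1 hj)]
      exact exampleHeight_zero j
    rw [point_eq_add_point_tail (n + 1) g, this]
    simp
  · rintro ⟨e, ⟨k, hk, rfl⟩, g, hg, hx⟩
    have hs : point (Pi.single n ⟨k, hk⟩) = (exampleHeight n k : ℤ_[5]) := by
      rw [point, tsum_eq_single n]
      · simp
      · intro j hj
        simp [hj, exampleHeight_zero]
    refine ⟨Pi.single n ⟨k, hk⟩ + g, fun j hj => ?_, ?_⟩
    · simp [hj.ne, hg j (by omega)]
    · rw [point_add fun j => ?_, hs, hx]
      · simp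
      · rcases eq_or_ne j n with rfl | h
        · exact Or.inr (hg j (by omega))
        · simp [h]

theorem level_eq_iUnion (n : ℕ) (a : ℤ) :
    level n a = ⋃ e ∈ exampleCutStack.heightSet n, level (n + 1) (a + e) := by
  ext x
  change x - a ∈ base n ↔ _
  rw [base_eq_iUnion]
  simp [level, sub_sub]

theorem mem_base_zero_iff {x : ℤ_[5]} : x ∈ base 0 ↔ ∃ g, point g = x := by
  simp [base, tailSet]

end ZeroTypeExample

/-! ### The invariant measure. -/

namespace ZeroTypeExample

/-- The Haar probability measure on the group of sequences of digits. -/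
noncomputable def digitMeasure : Measure Digits := Measure.addHaarMeasure ⊤

instance : digitMeasure.IsAddHaarMeasure := Measure.isAddHaarMeasure_addHaarMeasure _

instance : IsProbabilityMeasure digitMeasure := ⟨Measure.addHaarMeasure_self⟩

/-- The probability measure on `B_0`. -/
noncomputable def baseMeasure : Measure ℤ_[5] := digitMeasure.map point

instance : IsProbabilityMeasure baseMeasure :=
  Measure.isProbabilityMeasure_map continuous_point.measurable.aemeasurable

theorem baseMeasure_base_zero : baseMeasure (base 0) = 1 := by
  rw [baseMeasure, Measure.map_apply continuous_point.measurable (measurableSet_base 0),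
    Set.preimage_eq_univ_iff.2, measure_univ]
  rintro _ ⟨g, rfl⟩
  exact mem_base_zero_iff.2 ⟨g, rfl⟩

theorem baseMeasure_compl_base_zero : baseMeasure (base 0)ᶜ = 0 :=
  (prob_compl_eq_zero_iff (measurableSet_base 0)).2 baseMeasure_base_zero

/-- On sequences vanishing below `n`, adding `head n g` in the digit group corresponds to adding the
partial height in `ℤ_[5]`. Haar invariance then identifies each level inside `B_0` with `B_n`. -/
theorem baseMeasure_inter_level (n : ℕ) (g : Digits) {A : Set ℤ_[5]} (hA : MeasurableSet A) :
    baseMeasure (A ∩ level n (partialHeight n g)) =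
      baseMeasure ({y | y + ((partialHeight n g : ℤ) : ℤ_[5]) ∈ A} ∩ base n) := by
  have hA' : MeasurableSet {y : ℤ_[5] | y + ((partialHeight n g : ℤ) : ℤ_[5]) ∈ A} :=
    (measurable_add_const _) hA
  rw [baseMeasure, Measure.map_apply continuous_point.measurable (hA.inter (measurableSet_level _ _)),
    Measure.map_apply continuous_point.measurable (hA'.inter (measurableSet_base _)),
    ← measure_preimage_add digitMeasure (head n g)]
  have hadd : ∀ t ∈ tailSet n, point (head n g + t) = partialHeight n g + point t := by
    intro t ht
    rw [point_add fun j => ?_, point_head]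
    by_cases h : j < n
    · exact Or.inr (ht j h)
    · exact Or.inl (if_neg h)
  congr 1
  ext t
  simp only [Set.mem_preimage, Set.mem_inter_iff, Set.mem_ofPred_eq, level, Int.cast_natCast]
  constructor
  · rintro ⟨h1, s, hs, h2⟩
    have h3 : head n g + t = head n g + s := point_injective (by rw [hadd s hs, h2]; ring)
    obtain rfl : t = s := add_left_cancel h3
    rw [hadd t hs, add_comm] at h1
    exact ⟨h1, Set.mem_image_of_mem _ hs⟩
  · rintro ⟨h1, s, hs, h2⟩
    obtain rfl := point_injective h2
    rw [hadd s hs, add_sub_cancel_left, add_comm]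
    exact ⟨h1, Set.mem_image_of_mem _ hs⟩

theorem baseMeasure_level (n : ℕ) (g : Digits) :
    baseMeasure (level n (partialHeight n g)) = baseMeasure (base n) := by
  simpa using baseMeasure_inter_level n g MeasurableSet.univ

theorem tendsto_baseMeasure_base : Tendsto (fun n => baseMeasure (base n)) atTop (nhds 0) := by
  refine ENNReal.tendsto_zero_of_two_mul_le (measure_ne_top _ _) fun n => ?_
  obtain ⟨e, he, h0⟩ := exampleCutStack.exists_ne_zero_mem_heightSet n
  have hlt := exampleCutStack.add_height_le_of_mem_heightSet he
  rw [height_exampleCutStack, height_exampleCutStack] at hlt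
  have hpos := exampleScale_pos n
  have hsub : level (n + 1) (0 : ℕ) ∪ level (n + 1) e ⊆ base n := by
    rw [base_eq_iUnion]
    exact Set.union_subset (Set.subset_biUnion_of_mem (u := fun e : ℕ => level (n + 1) e)
      (exampleCutStack.zero_mem_heightSet n))
      (Set.subset_biUnion_of_mem (u := fun e : ℕ => level (n + 1) e) he)
  have hd : Disjoint (level (n + 1) (0 : ℕ)) (level (n + 1) e) :=
    disjoint_level (by omega) (by omega) (by omega) (by omega) (by omega)
  have he' : baseMeasure (level (n + 1) e) = baseMeasure (base (n + 1)) := by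
    rw [heightSet_exampleCutStack, ← image_exampleHeight] at he
    obtain ⟨k, hk, rfl⟩ := Finset.mem_image.1 he
    have : partialHeight (n + 1) (Pi.single n ⟨k, Finset.mem_range.1 hk⟩) = exampleHeight n k := by
      rw [partialHeight, Finset.sum_range_succ, Finset.sum_eq_zero, zero_add]
      · simp
      · intro j hj
        simp [(Finset.mem_range.1 hj).ne, exampleHeight_zero]
    rw [← this]
    exact baseMeasure_level _ _
  have := measure_mono (μ := baseMeasure) hsub
  rwa [measure_union hd (measurableSet_level _ _), he', Nat.cast_zero, level_zero,
    ← two_mul] at this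

open Classical in
/-- The levels of `C_n` contained in `B_0`. -/
noncomputable def baseLevels (n : ℕ) : Finset ℕ :=
  (Finset.range (exampleScale n)).filter fun d => ∃ g, partialHeight n g = d

theorem mem_baseLevels {n d : ℕ} : d ∈ baseLevels n ↔ ∃ g, partialHeight n g = d := by
  simp only [baseLevels, Finset.mem_filter, and_iff_right_iff_imp]
  rintro ⟨g, rfl⟩
  exact Finset.mem_range.2 (partialHeight_lt n g)

theorem base_zero_subset (n : ℕ) : base 0 ⊆ ⋃ d ∈ baseLevels n, level n (d : ℕ) := by
  intro x hx
  obtain ⟨g, rfl⟩ := mem_base_zero_iff.1 hx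
  refine Set.mem_biUnion (mem_baseLevels.2 ⟨g, rfl⟩) ⟨tail n g, tail_mem_tailSet n g, ?_⟩
  rw [point_eq_add_point_tail n g]
  simp

/-- The levels of `C_n` that are pushed out of `C_n` by a translation. -/
noncomputable def outLevels (n : ℕ) (z : ℤ) : Finset ℕ :=
  (Finset.range (exampleScale n)).filter fun d : ℕ => ¬ (0 ≤ d + z ∧ d + z < exampleScale n)

theorem card_outLevels_le (n : ℕ) (z : ℤ) : (outLevels n z).card ≤ z.natAbs := by
  rcases le_total 0 z with hz | hz
  · have : outLevels n z ⊆ Finset.Ico (exampleScale n - z.natAbs) (exampleScale n) := by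
      intro d hd
      simp only [outLevels, Finset.mem_filter, Finset.mem_range, Finset.mem_Ico] at hd ⊢
      omega
    refine (Finset.card_le_card this).trans ?_
    rw [Nat.card_Ico]
    omega
  · have : outLevels n z ⊆ Finset.range z.natAbs := by
      intro d hd
      simp only [outLevels, Finset.mem_filter, Finset.mem_range] at hd ⊢
      omega
    exact (Finset.card_le_card this).trans_eq (Finset.card_range _)

/-- Cut `B_0` into levels of `C_n`. Those staying in `C_n` after translation by `z` inject into
disjoint levels without gaining mass in `A`; at most `|z|` others are pushed out, each costing at
most one level. -/
theorem baseMeasure_translate_le_add (n : ℕ) (z : ℤ) {A : Set ℤ_[5]} (hA : MeasurableSet A)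
    (hA0 : A ⊆ base 0) : baseMeasure {x | x + (z : ℤ_[5]) ∈ A} ≤
      baseMeasure A + z.natAbs * baseMeasure (base n) := by
  classical
  have hmeas : ∀ a : ℤ, MeasurableSet {x : ℤ_[5] | x + (a : ℤ_[5]) ∈ A} := fun a =>
    (measurable_add_const _) hA
  set I := (baseLevels n).filter fun d : ℕ => 0 ≤ d + z ∧ d + z < exampleScale n with hI
  set O := (baseLevels n).filter fun d : ℕ => ¬ (0 ≤ d + z ∧ d + z < exampleScale n) with hO
  have hsub : baseMeasure {x | x + (z : ℤ_[5]) ∈ A} ≤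
      ∑ d ∈ baseLevels n, baseMeasure ({x | x + (z : ℤ_[5]) ∈ A} ∩ level n d) := by
    rw [← measure_inter_add_sdiff {x : ℤ_[5] | x + (z : ℤ_[5]) ∈ A} (measurableSet_base 0),
      measure_mono_null (s := _ \ base 0) (fun x hx => hx.2) baseMeasure_compl_base_zero,
      add_zero]
    refine (measure_mono ?_).trans (measure_biUnion_finset_le _ _)
    rw [← Set.inter_iUnion₂]
    exact Set.inter_subset_inter_right _ (base_zero_subset n)
  have hterm : ∀ d ∈ baseLevels n, baseMeasure ({x | x + (z : ℤ_[5]) ∈ A} ∩ level n d) =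
      baseMeasure ({x | x + ((d + z : ℤ) : ℤ_[5]) ∈ A} ∩ base n) := by
    intro d hd
    obtain ⟨g, rfl⟩ := mem_baseLevels.1 hd
    rw [baseMeasure_inter_level n g (hmeas z)]
    simp [add_assoc]
  have hin : ∀ d ∈ I, baseMeasure ({x | x + (z : ℤ_[5]) ∈ A} ∩ level n d) ≤
      baseMeasure (A ∩ level n (d + z)) := by
    intro d hd
    obtain ⟨hd, h0, h1⟩ := Finset.mem_filter.1 hd
    rw [hterm d hd]
    -- A point here translates into `A ⊆ B_0`; comparing residues modulo `h_n` shows that `d + z` is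
    -- itself a partial height.
    rcases Set.eq_empty_or_nonempty ({x | x + ((d + z : ℤ) : ℤ_[5]) ∈ A} ∩ base n) with he | ⟨y, hy⟩
    · rw [he, measure_empty]
      exact zero_le
    · obtain ⟨g, hg⟩ := mem_base_zero_iff.1 (hA0 hy.1)
      have : (d : ℤ) + z = partialHeight n g := by
        refine eq_of_norm_sub_le h0 h1 (by positivity) (by exact_mod_cast partialHeight_lt n g)
          (x := point g) ?_ (by exact_mod_cast norm_point_sub_le n g)
        rw [hg, add_sub_cancel_right]
        exact norm_le_of_mem_base hy.2
      rw [this, baseMeasure_inter_level n g hA]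
  have hout : ∀ d ∈ O, baseMeasure ({x | x + (z : ℤ_[5]) ∈ A} ∩ level n d) ≤
      baseMeasure (base n) := by
    intro d hd
    rw [hterm d (Finset.mem_filter.1 hd).1]
    exact measure_mono Set.inter_subset_right
  refine hsub.trans ?_
  rw [← Finset.sum_filter_add_sum_filter_not (baseLevels n)
    (fun d : ℕ => 0 ≤ d + z ∧ d + z < exampleScale n), ← hI, ← hO]
  refine add_le_add ((Finset.sum_le_sum hin).trans ?_) ((Finset.sum_le_sum hout).trans ?_)
  · rw [← measure_biUnion_finset]
    · exact measure_mono (Set.iUnion₂_subset fun _ _ => Set.inter_subset_left)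
    · intro d hd d' hd' hne
      obtain ⟨-, h0, h1⟩ := Finset.mem_filter.1 hd
      obtain ⟨-, h0', h1'⟩ := Finset.mem_filter.1 hd'
      exact (disjoint_level h0 h1 h0' h1' (by omega)).mono Set.inter_subset_right
        Set.inter_subset_right
    · exact fun d _ => hA.inter (measurableSet_level _ _)
  · rw [Finset.sum_const, nsmul_eq_mul]
    refine mul_le_mul_left ?_ _
    have : O ⊆ outLevels n z := Finset.filter_subset_filter _ (Finset.filter_subset _ _)
    exact_mod_cast (Finset.card_le_card this).trans (card_outLevels_le n z)

theorem baseMeasure_translate_le (z : ℤ) {A : Set ℤ_[5]} (hA : MeasurableSet A)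
    (hA0 : A ⊆ base 0) : baseMeasure {x | x + (z : ℤ_[5]) ∈ A} ≤ baseMeasure A := by
  have h : Tendsto (fun n => baseMeasure A + z.natAbs * baseMeasure (base n)) atTop
      (nhds (baseMeasure A + z.natAbs * 0)) :=
    tendsto_const_nhds.add (ENNReal.Tendsto.const_mul tendsto_baseMeasure_base
      (Or.inr (ENNReal.natCast_ne_top _)))
  rw [mul_zero, add_zero] at h
  exact ge_of_tendsto' h fun n => baseMeasure_translate_le_add n z hA hA0

/-- The invariant measure: the supremum of the translates of the measure on `B_0`. -/
noncomputable def exampleMeasure : Measure ℤ_[5] :=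
  ⨆ z : ℤ, baseMeasure.map (· + (z : ℤ_[5]))

/-- Translation by an integer merely reindexes the supremum. -/
theorem exampleMeasure_map_le (a : ℤ) :
    exampleMeasure ≤ exampleMeasure.map (· + (a : ℤ_[5])) := by
  refine iSup_le fun z => ?_
  have h := Measure.map_mono (le_iSup (fun z : ℤ => baseMeasure.map (· + (z : ℤ_[5]))) (z - a))
    (measurable_add_const (a : ℤ_[5]))
  rw [Measure.map_map (measurable_add_const _) (measurable_add_const _)] at h
  have hcomp : ((· + (a : ℤ_[5])) ∘ (· + ((z - a : ℤ) : ℤ_[5]))) = (· + (z : ℤ_[5])) := by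
    funext x
    simp [add_assoc]
  rwa [hcomp] at h

theorem measure_translate (a : ℤ) {A : Set ℤ_[5]} (hA : MeasurableSet A) :
    exampleMeasure {x | x + (a : ℤ_[5]) ∈ A} = exampleMeasure A := by
  have key : ∀ (a : ℤ) {A : Set ℤ_[5]}, MeasurableSet A →
      exampleMeasure A ≤ exampleMeasure {x | x + (a : ℤ_[5]) ∈ A} := by
    intro a A hA
    have := exampleMeasure_map_le a A
    rwa [Measure.map_apply (measurable_add_const _) hA] at this
  refine le_antisymm ?_ (key a hA)
  have := key (-a) (A := {x | x + (a : ℤ_[5]) ∈ A}) ((measurable_add_const _) hA)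
  simpa [add_assoc] using this

theorem exampleMeasure_level (n : ℕ) (a : ℤ) :
    exampleMeasure (level n a) = exampleMeasure (base n) := by
  rw [← measure_translate (-a) (measurableSet_base n)]
  simp [level, sub_eq_add_neg]

/-- On `B_0` every translate is dominated by `baseMeasure`; off `B_0` the crude bound by the sum of
all translates suffices, since it does not charge `A`. -/
theorem exampleMeasure_le {A : Set ℤ_[5]} (hA : MeasurableSet A) (hA0 : A ⊆ base 0) :
    exampleMeasure A ≤ baseMeasure A := by
  have hle : exampleMeasure ≤ baseMeasure + Measure.sum fun z : ℤ =>
      (baseMeasure.map (· + (z : ℤ_[5]))).restrict (base 0)ᶜ := by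
    refine iSup_le fun z => ?_
    rw [← Measure.restrict_add_restrict_compl (μ := baseMeasure.map (· + (z : ℤ_[5])))
      (measurableSet_base 0)]
    refine add_le_add (Measure.le_iff.2 fun S hS => ?_) (Measure.le_sum
      (fun z : ℤ => (baseMeasure.map (· + (z : ℤ_[5]))).restrict (base 0)ᶜ) z)
    rw [Measure.restrict_apply hS, Measure.map_apply (measurable_add_const _)
      (hS.inter (measurableSet_base 0))]
    exact (baseMeasure_translate_le z (hS.inter (measurableSet_base 0))
      Set.inter_subset_right).trans (measure_mono Set.inter_subset_left)
  refine (hle A).trans ?_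
  rw [Measure.add_apply, Measure.sum_apply _ hA]
  have : A ∩ (base 0)ᶜ = ∅ := by
    rw [← Set.sdiff_eq, Set.sdiff_eq_empty.2 hA0]
  simp [Measure.restrict_apply hA, this]

theorem base_subset_base_zero (n : ℕ) : base n ⊆ base 0 :=
  Set.image_mono fun _ _ j hj => absurd hj (Nat.not_lt_zero j)

theorem exampleMeasure_base_zero : exampleMeasure (base 0) = 1 := by
  refine le_antisymm ((exampleMeasure_le (measurableSet_base 0) subset_rfl).trans_eq
    baseMeasure_base_zero) ?_
  have := le_iSup (fun z : ℤ => baseMeasure.map (· + (z : ℤ_[5]))) 0 (base 0)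
  simp only [Int.cast_zero, add_zero, Measure.map_id', baseMeasure_base_zero] at this
  exact this

theorem tendsto_exampleMeasure_base :
    Tendsto (fun n => exampleMeasure (base n)) atTop (nhds 0) :=
  tendsto_of_tendsto_of_tendsto_of_le_of_le tendsto_const_nhds tendsto_baseMeasure_base
    (fun _ => zero_le) fun n => exampleMeasure_le (measurableSet_base n) (base_subset_base_zero n)

theorem exampleMeasure_compl_iUnion : exampleMeasure (⋃ z : ℤ, level 0 z)ᶜ = 0 := by
  have hm : MeasurableSet (⋃ z : ℤ, level 0 z)ᶜ :=
    (MeasurableSet.iUnion fun z => measurableSet_level 0 z).compl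
  have hle : exampleMeasure ≤ Measure.sum fun z : ℤ => baseMeasure.map (· + (z : ℤ_[5])) :=
    iSup_le fun z => Measure.le_sum (fun z : ℤ => baseMeasure.map (· + (z : ℤ_[5]))) z
  refine le_antisymm ((hle _).trans_eq ?_) zero_le
  rw [Measure.sum_apply _ hm, ENNReal.tsum_eq_zero]
  intro z
  rw [Measure.map_apply (measurable_add_const _) hm]
  refine measure_mono_null (t := (base 0)ᶜ) (fun x hx hx0 => hx ?_) baseMeasure_compl_base_zero
  exact Set.mem_iUnion.2 ⟨z, by simpa [level] using hx0⟩

instance : SigmaFinite exampleMeasure := by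
  refine Measure.sigmaFinite_of_countable
    (S := insert (⋃ z : ℤ, level 0 z)ᶜ (Set.range fun z : ℤ => level 0 z))
    ((Set.countable_range _).insert _) ?_ ?_
  · rintro s (rfl | ⟨z, rfl⟩)
    · rw [exampleMeasure_compl_iUnion]
      exact ENNReal.zero_lt_top
    · simp [exampleMeasure_level, exampleMeasure_base_zero]
  · rw [Set.sUnion_insert, Set.sUnion_range, Set.compl_union_self]

end ZeroTypeExample

/-! ### Exhaustion by columns and approximation by levels. -/

namespace ZeroTypeExample

/-- The column `C_n`. -/
noncomputable def column (n : ℕ) : Set ℤ_[5] := ⋃ i ∈ Finset.range (exampleScale n), level n (i : ℕ)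

theorem measurableSet_column (n : ℕ) : MeasurableSet (column n) :=
  Finset.measurableSet_biUnion _ fun _ _ => measurableSet_level _ _

theorem mem_column {n : ℕ} {x : ℤ_[5]} :
    x ∈ column n ↔ ∃ i < exampleScale n, x ∈ level n (i : ℕ) := by
  simp [column]

/-- Every point of `C_N` lies in a level of `C_n` contained in `C_N`, for `N ≤ n`. -/
theorem exists_level_subset_column {N n : ℕ} (h : N ≤ n) {x : ℤ_[5]} (hx : x ∈ column N) :
    ∃ i < exampleScale n, x ∈ level n (i : ℕ) ∧ level n (i : ℕ) ⊆ column N := by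
  induction n, h using Nat.le_induction with
  | base =>
    obtain ⟨i, hi, hxi⟩ := mem_column.1 hx
    exact ⟨i, hi, hxi, fun y hy => mem_column.2 ⟨i, hi, hy⟩⟩
  | succ n _ ih =>
    obtain ⟨i, hi, hxi, hsub⟩ := ih
    rw [level_eq_iUnion] at hxi hsub
    simp only [Set.mem_iUnion] at hxi
    obtain ⟨e, he, hxe⟩ := hxi
    have hlt := exampleCutStack.add_height_le_of_mem_heightSet he
    rw [height_exampleCutStack, height_exampleCutStack] at hlt
    refine ⟨i + e, by omega, by exact_mod_cast hxe, ?_⟩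
    have hsub' := (Set.subset_biUnion_of_mem (u := fun e : ℕ => level (n + 1) (i + e)) he).trans hsub
    exact_mod_cast hsub'

theorem column_mono : Monotone column := fun _ _ h _ hx =>
  let ⟨i, hi, hxi, _⟩ := exists_level_subset_column h hx
  mem_column.2 ⟨i, hi, hxi⟩

theorem exampleMeasure_column_lt_top (n : ℕ) : exampleMeasure (column n) < ⊤ :=
  measure_biUnion_lt_top (Finset.finite_toSet _) fun i _ => by
    rw [exampleMeasure_level]
    exact ((measure_mono (base_subset_base_zero n)).trans_eq exampleMeasure_base_zero).trans_lt
      ENNReal.one_lt_top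

/-- Only the at most `|z|` levels of `C_n` pushed out by the translation can contribute. Letting `n
→ ∞`, the columns exhaust every translate of `B_0`. -/
theorem exampleMeasure_level_sdiff_column (n : ℕ) (z : ℤ) :
    exampleMeasure (level 0 z \ column n) ≤ z.natAbs * exampleMeasure (base n) := by
  have hsub : level 0 z \ column n ⊆ ⋃ d ∈ outLevels n z, level n (d + z) := by
    rintro x ⟨hx, hxn⟩
    obtain ⟨d, hd, hxd⟩ := Set.mem_iUnion₂.1 (base_zero_subset n hx)
    have hxdz : x ∈ level n (d + z) := by
      have h : x - z - (d : ℤ) ∈ base n := hxd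
      change x - ((d + z : ℤ) : ℤ_[5]) ∈ base n
      rwa [Int.cast_add, add_comm, ← sub_sub]
    obtain ⟨g, rfl⟩ := mem_baseLevels.1 hd
    refine Set.mem_biUnion (Finset.mem_coe.2 (Finset.mem_filter.2
      ⟨Finset.mem_range.2 (partialHeight_lt n g), ?_⟩)) hxdz
    rintro ⟨h0, h1⟩
    refine hxn (mem_column.2 ⟨(partialHeight n g + z : ℤ).toNat, by omega, ?_⟩)
    rwa [Int.toNat_of_nonneg h0]
  refine (measure_mono hsub).trans ((measure_biUnion_finset_le _ _).trans ?_)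
  simp only [exampleMeasure_level, Finset.sum_const, nsmul_eq_mul]
  exact mul_le_mul_left (by exact_mod_cast card_outLevels_le n z) _

theorem exampleMeasure_compl_iUnion_column : exampleMeasure (⋃ n, column n)ᶜ = 0 := by
  have hz : ∀ z : ℤ, exampleMeasure (level 0 z \ ⋃ n, column n) = 0 := by
    intro z
    have h : Tendsto (fun n => z.natAbs * exampleMeasure (base n)) atTop
        (nhds (z.natAbs * 0)) :=
      ENNReal.Tendsto.const_mul tendsto_exampleMeasure_base (Or.inr (ENNReal.natCast_ne_top _))
    rw [mul_zero] at h
    exact le_antisymm (ge_of_tendsto' h fun n => (measure_mono (Set.sdiff_subset_sdiff_right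
      (Set.subset_iUnion column n))).trans (exampleMeasure_level_sdiff_column n z)) zero_le
  refine measure_mono_null (t := (⋃ z : ℤ, level 0 z)ᶜ ∪ ⋃ z : ℤ, level 0 z \ ⋃ n, column n) ?_
    (measure_union_null exampleMeasure_compl_iUnion (measure_iUnion_null hz))
  intro x hx
  by_cases h : x ∈ ⋃ z : ℤ, level 0 z
  · obtain ⟨z, hz⟩ := Set.mem_iUnion.1 h
    exact Or.inr (Set.mem_iUnion.2 ⟨z, hz, hx⟩)
  · exact Or.inl h

theorem tendsto_measure_sdiff_column {A : Set ℤ_[5]} (hA : MeasurableSet A)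
    (hfin : exampleMeasure A < ⊤) :
    Tendsto (fun n => exampleMeasure (A \ column n)) atTop (nhds 0) := by
  have h := tendsto_measure_iInter_atTop (μ := exampleMeasure) (s := fun n => A \ column n)
    (fun n => (hA.diff (measurableSet_column n)).nullMeasurableSet)
    (fun _ _ hmn => Set.sdiff_subset_sdiff_right (column_mono hmn))
    ⟨0, ((measure_mono Set.sdiff_subset).trans_lt hfin).ne⟩
  have h0 : exampleMeasure (⋂ n, A \ column n) = 0 := by
    refine measure_mono_null (t := (⋃ n, column n)ᶜ) (fun x hx hxn => ?_)
      exampleMeasure_compl_iUnion_column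
    obtain ⟨n, hn⟩ := Set.mem_iUnion.1 hxn
    exact (Set.mem_iInter.1 hx n).2 hn
  rwa [h0] at h

theorem exists_levels_approx {A : Set ℤ_[5]} (hA : MeasurableSet A)
    (hfin : exampleMeasure A < ⊤) {ε : ENNReal} (hε : 0 < ε) :
    ∃ N, ∀ n ≥ N, ∃ S ⊆ Finset.range (exampleScale n),
      exampleMeasure (symmDiff A (⋃ i ∈ S, level n (i : ℕ))) < ε := by
  classical
  obtain ⟨δ, hδ, hδε⟩ : ∃ δ : ENNReal, 0 < δ ∧ δ + δ + δ ≤ ε := by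
    refine ⟨ε / 3, ENNReal.div_pos hε.ne' (by simp), ?_⟩
    rw [ENNReal.add_thirds]
  obtain ⟨N, hN⟩ := ((tendsto_measure_sdiff_column hA hfin).eventually_lt_const hδ).exists
  -- Restricting to one column gives a finite measure, hence regularity. The three errors `δ` come
  -- from `A` outside `C_N`, from the inner closed set `K`, and from the outer open set `U`.
  have hfinN : IsFiniteMeasure (exampleMeasure.restrict (column N)) :=
    ⟨by rw [Measure.restrict_apply_univ]; exact exampleMeasure_column_lt_top N⟩
  have hAN := hA.inter (measurableSet_column N)
  obtain ⟨K, hKA, hK, hKδ⟩ := hAN.exists_isClosed_sdiff_lt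
    (μ := exampleMeasure.restrict (column N)) (measure_ne_top _ _) hδ.ne'
  obtain ⟨U, hAU, hU, -, hUδ⟩ := hAN.exists_isOpen_sdiff_lt
    (μ := exampleMeasure.restrict (column N)) (measure_ne_top _ _) hδ.ne'
  rw [Measure.restrict_apply' (measurableSet_column N)] at hKδ hUδ
  obtain ⟨ρ, hρ, hρU⟩ := hK.isCompact.exists_thickening_subset_open hU (hKA.trans hAU)
  obtain ⟨M, hM⟩ := exists_pow_lt_of_lt_one hρ (show (5⁻¹ : ℝ) < 1 by norm_num)
  refine ⟨max N M, fun n hn => ⟨(Finset.range (exampleScale n)).filter fun i =>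
    level n (i : ℕ) ⊆ column N ∧ (level n (i : ℕ) ∩ K).Nonempty, Finset.filter_subset _ _, ?_⟩⟩
  set V := ⋃ i ∈ (Finset.range (exampleScale n)).filter fun i =>
    level n (i : ℕ) ⊆ column N ∧ (level n (i : ℕ) ∩ K).Nonempty, level n (i : ℕ) with hV
  have hVN : V ⊆ column N := Set.iUnion₂_subset fun i hi => (Finset.mem_filter.1 hi).2.1
  -- A level of `C_n` has diameter at most `radius n < ρ`, so one meeting `K` stays in the
  -- `ρ`-thickening of `K`, which lies in `U` by compactness.
  have hVU : V ⊆ U := by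
    refine Set.iUnion₂_subset fun i hi x hx => hρU ?_
    obtain ⟨y, hy, hyK⟩ := (Finset.mem_filter.1 hi).2.2
    refine Metric.mem_thickening_iff.2 ⟨y, hyK, ?_⟩
    rw [dist_eq_norm]
    have h1 := norm_le_of_mem_base hx
    have h2 := norm_le_of_mem_base hy
    rw [norm_sub_rev] at h2
    have h3 := IsUltrametricDist.norm_add_le_max (x - ((i : ℕ) : ℤ)) (((i : ℕ) : ℤ) - y)
    rw [sub_add_sub_cancel] at h3
    calc ‖x - y‖ ≤ radius n := h3.trans (max_le h1 h2)
      _ ≤ (5⁻¹ : ℝ) ^ n := radius_le n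
      _ ≤ (5⁻¹ : ℝ) ^ M := pow_le_pow_of_le_one (by norm_num) (by norm_num)
          ((le_max_right _ _).trans hn)
      _ < ρ := hM
  have hKV : K ⊆ V := by
    intro x hx
    obtain ⟨i, hi, hxi, hsub⟩ := exists_level_subset_column ((le_max_left _ _).trans hn) (hKA hx).2
    exact Set.mem_biUnion (Finset.mem_coe.2 (Finset.mem_filter.2
      ⟨Finset.mem_range.2 hi, hsub, x, hxi, hx⟩)) hxi
  have hsub : symmDiff A V ⊆ A \ column N ∪ ((A ∩ column N) \ K) ∩ column N ∪
      (U \ (A ∩ column N)) ∩ column N := by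
    rintro x (⟨hxA, hxV⟩ | ⟨hxV, hxA⟩)
    · by_cases hx : x ∈ column N
      · exact Or.inl (Or.inr ⟨⟨⟨hxA, hx⟩, fun h => hxV (hKV h)⟩, hx⟩)
      · exact Or.inl (Or.inl ⟨hxA, hx⟩)
    · exact Or.inr ⟨⟨hVU hxV, fun h => hxA h.1⟩, hVN hxV⟩
  calc exampleMeasure (symmDiff A V) ≤ _ := measure_mono hsub
    _ ≤ _ := (measure_union_le _ _).trans (add_le_add_left (measure_union_le _ _) _)
    _ < δ + δ + δ := ENNReal.add_lt_add (ENNReal.add_lt_add hN hKδ) hUδ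
    _ ≤ ε := hδε

/-- The transformation `x ↦ x + 1`. -/
noncomputable def shift : ℤ_[5] ≃ᵐ ℤ_[5] := MeasurableEquiv.addRight 1

theorem iterate_shift (i : ℕ) (x : ℤ_[5]) : shift^[i] x = x + i := by
  induction i with
  | zero => simp
  | succ i ih =>
    rw [Function.iterate_succ_apply', ih]
    simp [shift, add_assoc]

theorem iterate_shift_image_base (n i : ℕ) : shift^[i] '' base n = level n (i : ℕ) := by
  ext x
  simp only [Set.mem_image, iterate_shift, level, Set.mem_ofPred_eq, Int.cast_natCast]
  constructor
  · rintro ⟨y, hy, rfl⟩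
    rwa [add_sub_cancel_right]
  · exact fun h => ⟨_, h, sub_add_cancel _ _⟩

theorem isRankOneBy : IsRankOneBy exampleMeasure shift exampleCutStack base where
  measurePreserving := by
    refine ⟨shift.measurable, Measure.ext fun A hA => ?_⟩
    rw [shift.map_apply]
    have h := measure_translate 1 hA
    rw [Int.cast_one] at h
    exact h
  measurableSet_base := measurableSet_base
  base_zero_pos := by simp [exampleMeasure_base_zero]
  base_zero_lt_top := by simp [exampleMeasure_base_zero]
  levels_disjoint n i hi j hj hij := by
    rw [height_exampleCutStack] at hi hj
    rw [iterate_shift_image_base, iterate_shift_image_base]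
    exact disjoint_level (by positivity) (by exact_mod_cast hi) (by positivity)
      (by exact_mod_cast hj) (by exact_mod_cast hij)
  base_eq n := by
    simp_rw [iterate_shift_image_base]
    exact base_eq_iUnion n
  approx A hA hfin ε hε := by
    simp_rw [iterate_shift_image_base, height_exampleCutStack]
    exact exists_levels_approx hA hfin hε

end ZeroTypeExample

theorem mainTheorem12 :
    -- normality and unique representation exclude rational weak mixing
    (∀ (X : Type u) [MeasurableSpace X] (μ : Measure X) (T : X ≃ᵐ X) (P : CutStack)
        (B : ℕ → Set X), IsRankOneBy μ T P B → P.Normal → P.UniqueDifferences →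
        ¬ RationallyWeaklyMixing μ T) ∧
    -- steepness excludes rational weak mixing
    (∀ (X : Type u) [MeasurableSpace X] (μ : Measure X) (T : X ≃ᵐ X) (P : CutStack)
        (B : ℕ → Set X), IsRankOneBy μ T P B → P.Steep → ¬ RationallyWeaklyMixing μ T) ∧
    -- the zero-type, multiply recurrent example exists
    (∃ (X : Type) (_ : MeasurableSpace X) (_ : StandardBorelSpace X) (μ : Measure X)
        (_ : SigmaFinite μ) (T : X ≃ᵐ X) (P : CutStack) (B : ℕ → Set X),
        IsZeroTypeExample P ∧ IsRankOneBy μ T P B ∧ μ (B 0) = 1) ∧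
    -- and it is not rationally weakly mixing
    (∀ (X : Type u) [MeasurableSpace X] (μ : Measure X) (T : X ≃ᵐ X) (P : CutStack)
        (B : ℕ → Set X), IsZeroTypeExample P → IsRankOneBy μ T P B →
        ¬ RationallyWeaklyMixing μ T) := by
  refine ⟨fun X _ μ T P B h _ hP => h.not_rationallyWeaklyMixing hP,
    fun X _ μ T P B h hP => h.not_rationallyWeaklyMixing hP.uniqueDifferences,
    ⟨ℤ_[5], inferInstance, inferInstance, ZeroTypeExample.exampleMeasure, inferInstance,
      ZeroTypeExample.shift, exampleCutStack, ZeroTypeExample.base,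
      isZeroTypeExample_exampleCutStack, ZeroTypeExample.isRankOneBy,
      ZeroTypeExample.exampleMeasure_base_zero⟩,
    fun X _ μ T P B hP h => h.not_rationallyWeaklyMixing
      (CutStack.uniqueDifferences_of_heightSet_eq hP.2.2)⟩
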